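/- **Poset games.** A poset game is a finite partially ordered set; two players alternately choose a remaining element $v$ and remove all remaining elements $w\ge v$; a player who cannot move loses. Write $|G|$ for the number of elements of $G$. "Next to" means disjoint union with no relations between the parts, a $k$-tower is a chain of $k$ elements, and adding $k$ bottom vertices to $G$ means placing a new chain of $k$ elements below all of $G$. **Constructions.** $A\cup B$ is the disjoint union of $A$ and $B$ together with the relations $b\ge a$ for all $a\in A$, $b\in B$. For a game $G$ with $g$ vertices, $\neg G$ is obtained as follows: set $i=0$; while $2^i\le g$, add $2^i$ bottom vertices, then put a $2^i$-tower next to the result, then increase $i$ by $1$; call the result $G'$; add $2^i$ bottom vertices to $G'$ and put a $2^i$-tower next to it to get $G''$; increase $i$ by $1$; finally $\neg G$ consists of $G'$, $G''$ and a $2^i$-tower next to each other. Put $A\cap B=\neg(\neg A\cup\neg B)$. For a Boolean formula $\varphi$ with connectives $\neg$, $\wedge$, $\vee$ (the latter two binary), variables among $x_0,\dots,x_{n-1}$ and constants, and an assignment $x\in\{0,1\}^n$, the game $G_{\varphi,x}$ is obtained by replacing every leaf that is true by a single vertex and every leaf that is false by two isolated vertices, and every connective by the corresponding construction. Let the depth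 of $\varphi$ be the largest number of connectives on a path from the root to a leaf. **Statement.** 1. The first player wins $A\cup B$ iff the first player wins $A$ or wins $B$; and $|A\cup B|=|A|+|B|$. 2. The first player wins $\neg G$ iff the first player does not win $G$; and $|\neg G|\le 26\,|G|$ if $G$ is non-empty. 3. The first player wins $A\cap B$ iff the first player wins both $A$ and $B$; and $|A\cap B|\le 26^2(|A|+|B|)$ if $A$ and $B$ are non-empty. 4. For all $n$, $\varphi$ and $x$: $G_{\varphi,x}$ is a first-player win iff $\varphi$ is true under $x$. 5. For every $c$ there is a polynomial $p$ such that $|G_{\varphi,x}|\le p(n)$ for all $n$, all $\varphi$ in $n$ variables of depth at most $c(\lfloor\log_2 n\rfloor+1)$ (with $\log_2 0$ read as $0$) and all $x$. 6. Deciding the winner of a poset game is $NC^1$-hard. Precisely: let $W\subseteq\{0,1\}^*$ be the set of all $m\times m$ bit matrices, written row by row, which are the matrix of the relation $\le$ of a partial order on $\{0,\dots,m-1\}$ whose poset game is a first-player win. Let $L\subseteq\{0,1\}^*$ be any language in $NC^1$, that is, decided by a family of Boolean circuits of fan-in at most $2$, one for each input length $n$, of size polynomial in $n$ and depth $O(\log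 n)$. Then $L$ many-one reduces to $W$ by projections of polynomial size: for each $n$ there is a map $\{0,1\}^n\to\{0,1\}^{\ell(n)}$, with $\ell(n)$ bounded by a polynomial in $n$, each of whose output bits is a constant, a fixed input bit or the negation of one, such that an input of length $n$ is in $L$ iff its image is in $W$. (In particular this is a reduction by polynomial-size, constant-depth circuits.) -/

import Mathlib

/-! ### Poset games -/

/-- A poset game: a finite partially ordered set of vertices. -/
structure PosetGame where
  V : Type
  [order : PartialOrder V]
  [fintype : Fintype V]

attribute [instance] PosetGame.order PosetGame.fintype

open Classical in
/-- The player to move has a winning strategy when the set of remaining vertices is `S`.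
A move chooses some `v ∈ S` and removes every `w ∈ S` with `v ≤ w`; a player who cannot move loses.
So a position is winning iff some move leads to a losing position. -/
def PlayerToMoveWins {V : Type} [PartialOrder V] (S : Finset V) : Prop :=
  ∃ v, ∃ _ : v ∈ S, ¬ PlayerToMoveWins (S.filter fun w => ¬ v ≤ w)
termination_by S.card
decreasing_by
  apply Finset.card_lt_card
  refine Finset.filter_ssubset.2 ⟨v, by assumption, by simp⟩

namespace PosetGame

/-- The first player has a winning strategy from the starting position (all vertices present). -/
def FirstPlayerWins (G : PosetGame) : Prop :=
  PlayerToMoveWins (Finset.univ : Finset G.V)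

/-- The number of vertices. -/
def size (G : PosetGame) : ℕ := Fintype.card G.V

/-- The `k`-tower: a chain of `k` vertices. -/
def tower (k : ℕ) : PosetGame := ⟨Fin k⟩

/-- Two games next to each other: vertices of different components are incomparable. -/
def beside (A B : PosetGame) : PosetGame := ⟨A.V ⊕ B.V⟩

/-- `A` below `B`: the disjoint union with all vertices of `B` made greater than all vertices
of `A` (`⊕ₗ` is the ordinal sum). -/
def below (A B : PosetGame) : PosetGame := ⟨A.V ⊕ₗ B.V⟩

/-- Add `k` bottom vertices one after the other: each new vertex is below everything present,
so that the new vertices form a `k`-chain below `G`. -/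
def addBottom (k : ℕ) (G : PosetGame) : PosetGame := below (tower k) G

/-- One step of the procedure: add `2 ^ i` bottom vertices, then put a `2 ^ i`-tower
next to the result. -/
def step (i : ℕ) (G : PosetGame) : PosetGame :=
  beside (addBottom (2 ^ i) G) (tower (2 ^ i))

/-- The steps for `0, 1, …, i - 1`, in this order. -/
def steps : ℕ → PosetGame → PosetGame
  | 0, G => G
  | i + 1, G => step i (steps i G)

/-- The OR construction: the vertices of `A` and of `B`, with every vertex of `B` above every
vertex of `A`. -/
def or (A B : PosetGame) : PosetGame := below A B

/-- The NOT construction on a game `G` with `g` vertices. Starting with `i = 0`, the step for `i` is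
made while `2 ^ i ≤ g`; as `2 ^ i ≤ g ↔ i < Nat.size g` (`Nat.lt_size`), this ends with
`i = Nat.size g`, which is the number of binary digits of `g`. Call the result `G'`.
One more step, for this `i`, turns `G'` into `G''`.
The result is `G'` next to `G''` next to a `2 ^ (i + 1)`-tower. -/
def neg (G : PosetGame) : PosetGame :=
  let i := Nat.size G.size
  let G' := steps i G
  let G'' := step i G'
  beside (beside G' G'') (tower (2 ^ (i + 1)))

/-- The AND construction, `¬ (¬ A ∪ ¬ B)`. -/
def and (A B : PosetGame) : PosetGame := neg (or (neg A) (neg B))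

/-- A truth value as a game: a single vertex for true, two isolated vertices for false. -/
def ofBool : Bool → PosetGame
  | true => tower 1
  | false => beside (tower 1) (tower 1)

end PosetGame

/-! ### Boolean formulas -/

/-- Boolean formulas of fan-in at most two in the variables `x₀, …, xₙ₋₁`. -/
inductive BoolFormula (n : ℕ) : Type
  | const (b : Bool) : BoolFormula n
  | var (i : Fin n) : BoolFormula n
  | not (φ : BoolFormula n) : BoolFormula n
  | and (φ ψ : BoolFormula n) : BoolFormula n
  | or (φ ψ : BoolFormula n) : BoolFormula n

namespace BoolFormula

variable {n : ℕ}

/-- The truth value under the assignment `x`. -/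
def eval (x : Fin n → Bool) : BoolFormula n → Bool
  | const b => b
  | var i => x i
  | not φ => !(φ.eval x)
  | and φ ψ => φ.eval x && ψ.eval x
  | or φ ψ => φ.eval x || ψ.eval x

/-- The largest number of connectives on a path from the root to a leaf. -/
def depth : BoolFormula n → ℕ
  | const _ => 0
  | var _ => 0
  | not φ => φ.depth + 1
  | and φ ψ => max φ.depth ψ.depth + 1
  | or φ ψ => max φ.depth ψ.depth + 1

/-- The poset game of a formula under the assignment `x`: leaves become the games of their truth
values, connectives become the corresponding constructions. -/
def game (x : Fin n → Bool) : BoolFormula n → PosetGame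
  | const b => PosetGame.ofBool b
  | var i => PosetGame.ofBool (x i)
  | not φ => (φ.game x).neg
  | and φ ψ => (φ.game x).and (ψ.game x)
  | or φ ψ => (φ.game x).or (ψ.game x)

end BoolFormula

/-! ### Boolean circuits of bounded fan-in and the class `NC¹` -/

/-- A gate of fan-in at most two with `n` input variables and `s` earlier gates to read from. -/
inductive Gate (n s : ℕ) : Type
  | input (i : Fin n) : Gate n s
  | const (b : Bool) : Gate n s
  | not (a : Fin s) : Gate n s
  | and (a b : Fin s) : Gate n s
  | or (a b : Fin s) : Gate n s

/-- A Boolean circuit of fan-in at most two with `n` inputs: gates in topological order, where each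
gate reads input variables or earlier gates, and a gate chosen as output. -/
structure BoolCircuit (n : ℕ) where
  size : ℕ
  gate : (g : Fin size) → Gate n g
  output : Fin size

namespace BoolCircuit

variable {n : ℕ}

/-- The value of the gate `g` on the input `x`. -/
def gateVal (C : BoolCircuit n) (x : Fin n → Bool) (g : Fin C.size) : Bool :=
  match C.gate g with
  | .input i => x i
  | .const b => b
  | .not a => !(C.gateVal x ⟨a, a.2.trans g.2⟩)
  | .and a b => C.gateVal x ⟨a, a.2.trans g.2⟩ && C.gateVal x ⟨b, b.2.trans g.2⟩
  | .or a b => C.gateVal x ⟨a, a.2.trans g.2⟩ || C.gateVal x ⟨b, b.2.trans g.2⟩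
termination_by g.val

/-- The depth of the gate `g`: the length of a longest path to it from an input or constant. -/
def gateDepth (C : BoolCircuit n) (g : Fin C.size) : ℕ :=
  match C.gate g with
  | .input _ => 0
  | .const _ => 0
  | .not a => C.gateDepth ⟨a, a.2.trans g.2⟩ + 1
  | .and a b => max (C.gateDepth ⟨a, a.2.trans g.2⟩) (C.gateDepth ⟨b, b.2.trans g.2⟩) + 1
  | .or a b => max (C.gateDepth ⟨a, a.2.trans g.2⟩) (C.gateDepth ⟨b, b.2.trans g.2⟩) + 1
termination_by g.val

/-- The output bit on the input `x`. -/
def eval (C : BoolCircuit n) (x : Fin n → Bool) : Bool := C.gateVal x C.output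

/-- The depth of the circuit. -/
def depth (C : BoolCircuit n) : ℕ := Finset.univ.sup C.gateDepth

end BoolCircuit

/-- `L ∈ NC¹`: `L` is decided by a family of Boolean circuits of fan-in at most two, one for each
input length `n`, of size polynomial in `n` and depth `O(log n)`. -/
def InNC1 (L : Language Bool) : Prop :=
  ∃ C : (n : ℕ) → BoolCircuit n,
    (∃ p : Polynomial ℕ, ∀ n, (C n).size ≤ p.eval n) ∧
    (∃ c : ℕ, ∀ n, (C n).depth ≤ c * (Nat.log 2 n + 1)) ∧
    ∀ w : List Bool, w ∈ L ↔ (C w.length).eval w.get = true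

/-! ### Projections and hardness -/

/-- What one output bit of a projection on `n` input bits is: a constant, an input bit or a
negated input bit. -/
inductive ProjBit (n : ℕ) : Type
  | const (b : Bool) : ProjBit n
  | pos (i : Fin n) : ProjBit n
  | neg (i : Fin n) : ProjBit n

/-- The value of the output bit on the input `x`. -/
def ProjBit.eval {n : ℕ} (x : Fin n → Bool) : ProjBit n → Bool
  | .const b => b
  | .pos i => x i
  | .neg i => !(x i)

/-- `L` many-one reduces to `K` by projections of polynomial size: an input of length `n` is mapped
to a string whose length `ℓ n` is polynomially bounded, and each of whose bits is a constant, a fixed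
bit of the input or the negation of one. (In particular, the reduction is computed by circuits
of polynomial size and constant depth.) -/
def ProjReduces (L K : Language Bool) : Prop :=
  ∃ (ℓ : ℕ → ℕ) (π : (n : ℕ) → Fin (ℓ n) → ProjBit n),
    (∃ p : Polynomial ℕ, ∀ n, ℓ n ≤ p.eval n) ∧
    ∀ w : List Bool, w ∈ L ↔ List.ofFn (fun k => (π w.length k).eval w.get) ∈ K

/-- `K` is hard for `NC¹` (under projections of polynomial size). -/
def NC1Hard (K : Language Bool) : Prop :=
  ∀ L : Language Bool, InNC1 L → ProjReduces L K

open Classical in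
/-- A partial order on `{0, …, m - 1}` as a string of `m * m` bits, the matrix of `≤` row by row:
the bit at position `i * m + j` tells whether `i ≤ j` in the order. -/
noncomputable def encodeOrder {m : ℕ} (o : PartialOrder (Fin m)) : List Bool :=
  List.ofFn fun k : Fin (m * m) =>
    decide (o.le (finProdFinEquiv.symm k).1 (finProdFinEquiv.symm k).2)

/-- The problem of deciding the winner of a poset game: the strings that encode a finite partial
order whose poset game is a win for the first player. -/
def posetGameWinner : Language Bool :=
  {w | ∃ (m : ℕ) (o : PartialOrder (Fin m)),
    w = encodeOrder o ∧ (@PosetGame.mk (Fin m) o _).FirstPlayerWins}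

/-!
Sprague–Grundy theory explains the constructions. Every position has a Grundy value, which is
non-zero exactly when the player to move wins. Placing positions next to each other takes the
nim-sum of their values (`grundy_disjSum`), and adding `k` bottom vertices adds `k` to the value
(`grundy_lexPosition_fin`). Thus the step for `i` maps a value `x` to `(2 ^ i + x) ^^^ 2 ^ i`. This
replaces the number `x / 2 ^ i` formed by the digits from `i` on by its half, rounded up
(`add_xor_two_pow_div`). As the value of `G` is at most its size and so below `2 ^ N` for
`N = Nat.size G.size`, after the `N` steps a non-zero value has become some `x` with
`x / 2 ^ N = 1`, while the value zero stays zero. One more step turns such an `x` into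
`x + 2 ^ (N + 1)`, so that the nim-sum of `x`, `x + 2 ^ (N + 1)` and `2 ^ (N + 1)` is zero, whereas
the value zero leads to `2 ^ (N + 1)`. This is the NOT construction. For the OR construction no
values are needed: a move in the lower game removes the whole upper one
(`playerToMoveWins_lexPosition`).

Each connective multiplies the size by at most a constant, so that formulas of logarithmic depth
have games of polynomial size. A circuit of logarithmic depth unfolds into a formula of no larger
depth, which reduces its evaluation to a poset game. The vertices of the game `φ.game x` depend on
`x`, since a true leaf has one vertex and a false leaf has two, and this changes the number of steps
in the NOT constructions. For a projection the leaves are therefore replaced by games with two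
vertices in both cases, a chain for true and an antichain for false. Then only the order relation
depends on the input, and each bit of its matrix is a constant or an input bit
(`IsProjection.gameWith_pairOfBool`).
-/

/-! ### Positions and Grundy values -/

section Positions

variable {V W : Type} [PartialOrder V] [PartialOrder W]

open Classical in
/-- The position that remains of `S` after the vertex `v` is chosen. -/
noncomputable def cut (S : Finset V) (v : V) : Finset V := S.filter fun w => ¬ v ≤ w

@[simp] lemma mem_cut {S : Finset V} {v w : V} : w ∈ cut S v ↔ w ∈ S ∧ ¬ v ≤ w := by
  simp [cut]

lemma cut_ssubset {S : Finset V} {v : V} (hv : v ∈ S) : cut S v ⊂ S := by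
  classical exact Finset.filter_ssubset.2 ⟨v, hv, by simp⟩

lemma playerToMoveWins_iff (S : Finset V) :
    PlayerToMoveWins S ↔ ∃ v ∈ S, ¬ PlayerToMoveWins (cut S v) := by
  rw [PlayerToMoveWins]
  simp only [exists_prop, cut]

/-- The Grundy value of a position: the least natural number that is not the Grundy value of
a position reached by one move. -/
noncomputable def grundy (S : Finset V) : ℕ :=
  sInf {k | ∀ v, ∀ _ : v ∈ S, grundy (cut S v) ≠ k}
termination_by S.card
decreasing_by exact Finset.card_lt_card (cut_ssubset (by assumption))

lemma grundy_cut_ne {S : Finset V} {v : V} (hv : v ∈ S) : grundy (cut S v) ≠ grundy S := by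
  have hne : {k | ∀ v, ∀ _ : v ∈ S, grundy (cut S v) ≠ k}.Nonempty := by
    obtain ⟨k, hk⟩ := Infinite.exists_notMem_finset (S.image fun v => grundy (cut S v))
    exact ⟨k, fun v hv h => hk (Finset.mem_image.2 ⟨v, hv, h⟩)⟩
  have h := Nat.sInf_mem hne v hv
  rwa [← grundy] at h

lemma exists_grundy_cut_eq {S : Finset V} {m : ℕ} (hm : m < grundy S) :
    ∃ v ∈ S, grundy (cut S v) = m := by
  rw [grundy] at hm
  simpa using Nat.notMem_of_lt_sInf hm

lemma grundy_eq_of {S : Finset V} {n : ℕ} (h₁ : ∀ v ∈ S, grundy (cut S v) ≠ n)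
    (h₂ : ∀ m < n, ∃ v ∈ S, grundy (cut S v) = m) : grundy S = n := by
  refine le_antisymm (not_lt.1 fun h => ?_) (not_lt.1 fun h => ?_)
  · obtain ⟨v, hv, e⟩ := exists_grundy_cut_eq h
    exact h₁ v hv e
  · obtain ⟨v, hv, e⟩ := h₂ _ h
    exact grundy_cut_ne hv e

lemma playerToMoveWins_iff_grundy_ne_zero (S : Finset V) : PlayerToMoveWins S ↔ grundy S ≠ 0 := by
  induction S using Finset.strongInduction with
  | H S ih =>
    rw [playerToMoveWins_iff]
    constructor
    · rintro ⟨v, hv, h⟩ h0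
      rw [ih _ (cut_ssubset hv), not_not] at h
      exact grundy_cut_ne hv (h.trans h0.symm)
    · intro h
      obtain ⟨v, hv, e⟩ := exists_grundy_cut_eq (Nat.pos_of_ne_zero h)
      exact ⟨v, hv, by rw [ih _ (cut_ssubset hv)]; simpa using e⟩

lemma grundy_le_card (S : Finset V) : grundy S ≤ S.card := by
  induction S using Finset.strongInduction with
  | H S ih =>
    by_contra! h
    obtain ⟨v, hv, e⟩ := exists_grundy_cut_eq h
    have h₁ := ih _ (cut_ssubset hv)
    have h₂ := Finset.card_lt_card (cut_ssubset hv)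
    omega

lemma cut_map (e : V ↪o W) (S : Finset V) (v : V) :
    cut (S.map e.toEmbedding) (e v) = (cut S v).map e.toEmbedding := by
  ext w
  simp only [mem_cut, Finset.mem_map, RelEmbedding.coe_toEmbedding]
  constructor
  · rintro ⟨⟨u, hu, rfl⟩, h⟩
    exact ⟨u, ⟨hu, by simpa using h⟩, rfl⟩
  · rintro ⟨u, ⟨hu, h⟩, rfl⟩
    exact ⟨⟨u, hu, rfl⟩, by simpa using h⟩

lemma grundy_map (e : V ↪o W) (S : Finset V) : grundy (S.map e.toEmbedding) = grundy S := by
  induction S using Finset.strongInduction with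
  | H S ih =>
    apply grundy_eq_of
    · simp only [Finset.forall_mem_map, RelEmbedding.coe_toEmbedding]
      intro v hv
      rw [cut_map, ih _ (cut_ssubset hv)]
      exact grundy_cut_ne hv
    · intro m hm
      obtain ⟨v, hv, h⟩ := exists_grundy_cut_eq hm
      exact ⟨e v, Finset.mem_map_of_mem _ hv, by rw [cut_map, ih _ (cut_ssubset hv), h]⟩

lemma cut_disjSum_inl (S : Finset V) (T : Finset W) (v : V) :
    cut (S.disjSum T) (.inl v) = (cut S v).disjSum T := by
  ext (w | w) <;> simp

lemma cut_disjSum_inr (S : Finset V) (T : Finset W) (w : W) :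
    cut (S.disjSum T) (.inr w) = S.disjSum (cut T w) := by
  ext (v | v) <;> simp

/-- Sprague–Grundy: the Grundy value of two positions next to each other is the nim-sum of
the Grundy values. -/
lemma grundy_disjSum (S : Finset V) (T : Finset W) :
    grundy (S.disjSum T) = grundy S ^^^ grundy T := by
  induction S using Finset.strongInduction generalizing T with
  | H S ihS =>
  induction T using Finset.strongInduction with
  | H T ihT =>
    apply grundy_eq_of
    · rintro (v | w) h
      · have hv : v ∈ S := by simpa using h
        rw [cut_disjSum_inl, ihS _ (cut_ssubset hv)]
        exact fun e => grundy_cut_ne hv (Nat.xor_left_injective e)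
      · have hw : w ∈ T := by simpa using h
        rw [cut_disjSum_inr, ihT _ (cut_ssubset hw)]
        exact fun e => grundy_cut_ne hw (Nat.xor_right_injective e)
    · intro m hm
      rcases Nat.lt_xor_cases hm with h | h
      · obtain ⟨v, hv, e⟩ := exists_grundy_cut_eq h
        refine ⟨.inl v, by simpa using hv, ?_⟩
        rw [cut_disjSum_inl, ihS _ (cut_ssubset hv), e, Nat.xor_assoc, Nat.xor_self, Nat.xor_zero]
      · obtain ⟨w, hw, e⟩ := exists_grundy_cut_eq h
        refine ⟨.inr w, by simpa using hw, ?_⟩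
        rw [cut_disjSum_inr, ihT _ (cut_ssubset hw), e, Nat.xor_comm m, ← Nat.xor_assoc,
          Nat.xor_self, Nat.zero_xor]

/-- The position of an ordinal sum with all of `V` and the vertices of `T` above it. -/
def lexPosition (V : Type) [Fintype V] (T : Finset W) : Finset (V ⊕ₗ W) :=
  (Finset.univ.disjSum T).map toLex.toEmbedding

@[simp] lemma inlₗ_mem_lexPosition {V W : Type} [Fintype V] (T : Finset W) (v : V) :
    Sum.inlₗ v ∈ lexPosition V T := by
  simp [lexPosition, Sum.inlₗ]

@[simp] lemma inrₗ_mem_lexPosition {V W : Type} [Fintype V] {T : Finset W} {w : W} :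
    Sum.inrₗ w ∈ lexPosition V T ↔ w ∈ T := by
  simp [lexPosition, Sum.inrₗ]

/-- The lower summand of an ordinal sum as a suborder. -/
def lexInl (V W : Type) [PartialOrder V] [PartialOrder W] : V ↪o V ⊕ₗ W :=
  ⟨⟨Sum.inlₗ, Sum.inl_injective⟩, Sum.Lex.inl_le_inl_iff⟩

@[simp] lemma lexInl_apply (v : V) : lexInl V W v = toLex (Sum.inl v) := rfl

variable [Fintype V]

lemma cut_lexPosition_inlₗ (T : Finset W) (v : V) :
    cut (lexPosition V T) (Sum.inlₗ v) =
      (cut Finset.univ v).map (lexInl V W).toEmbedding := by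
  ext x
  rcases x with (u | u)
  · change Sum.inlₗ u ∈ _ ↔ Sum.inlₗ u ∈ _
    simp [Sum.inlₗ]
  · change Sum.inrₗ u ∈ _ ↔ Sum.inrₗ u ∈ _
    simp [Sum.inlₗ, Sum.inrₗ]

lemma cut_lexPosition_inrₗ (T : Finset W) (w : W) :
    cut (lexPosition V T) (Sum.inrₗ w) = lexPosition V (cut T w) := by
  ext x
  rcases x with (u | u)
  · change Sum.inlₗ u ∈ _ ↔ Sum.inlₗ u ∈ _
    simp [Sum.inlₗ, Sum.inrₗ]
  · change Sum.inrₗ u ∈ _ ↔ Sum.inrₗ u ∈ _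
    simp [Sum.inrₗ]

/-- If `V` is lost for the player to move, then neither player wants to move in it first, and the
game is decided by the play in `T`. -/
lemma playerToMoveWins_lexPosition (T : Finset W) :
    PlayerToMoveWins (lexPosition V T) ↔
      PlayerToMoveWins (Finset.univ : Finset V) ∨ PlayerToMoveWins T := by
  induction T using Finset.strongInduction with
  | H T ih =>
    have hV : PlayerToMoveWins (Finset.univ : Finset V) ↔
        ∃ v : V, ¬ PlayerToMoveWins (cut (lexPosition V T) (Sum.inlₗ v)) := by
      rw [playerToMoveWins_iff]
      simp only [cut_lexPosition_inlₗ, playerToMoveWins_iff_grundy_ne_zero, grundy_map,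
        Finset.mem_univ, true_and]
    have hW : (∃ w ∈ T, ¬ PlayerToMoveWins (cut (lexPosition V T) (Sum.inrₗ w))) ↔
        ¬ PlayerToMoveWins (Finset.univ : Finset V) ∧ PlayerToMoveWins T := by
      rw [playerToMoveWins_iff T]
      constructor
      · rintro ⟨w, hw, h⟩
        rw [cut_lexPosition_inrₗ, ih _ (cut_ssubset hw), not_or] at h
        exact ⟨h.1, w, hw, h.2⟩
      · rintro ⟨h, w, hw, h'⟩
        refine ⟨w, hw, ?_⟩
        rw [cut_lexPosition_inrₗ, ih _ (cut_ssubset hw), not_or]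
        exact ⟨h, h'⟩
    have hsplit : PlayerToMoveWins (lexPosition V T) ↔
        (∃ v : V, ¬ PlayerToMoveWins (cut (lexPosition V T) (Sum.inlₗ v))) ∨
        ∃ w ∈ T, ¬ PlayerToMoveWins (cut (lexPosition V T) (Sum.inrₗ w)) := by
      rw [playerToMoveWins_iff]
      constructor
      · rintro ⟨(v | w), hx, h⟩
        · exact .inl ⟨v, h⟩
        · exact .inr ⟨w, inrₗ_mem_lexPosition.1 hx, h⟩
      · rintro (⟨v, h⟩ | ⟨w, hw, h⟩)
        · exact ⟨_, inlₗ_mem_lexPosition T v, h⟩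
        · exact ⟨_, inrₗ_mem_lexPosition.2 hw, h⟩
    rw [hsplit, ← hV, hW]
    tauto

/-- The `j` lowest vertices of a tower have Grundy value `j`. -/
lemma grundy_fin_lt {k : ℕ} (j : ℕ) (hj : j ≤ k) :
    grundy (Finset.univ.filter fun i : Fin k => i.val < j) = j := by
  induction j using Nat.strong_induction_on with
  | _ j ih =>
    have hcut : ∀ v : Fin k, v.val < j →
        grundy (cut (Finset.univ.filter fun i : Fin k => i.val < j) v) = v.val := by
      intro v hv
      rw [← ih v hv v.2.le]
      congr 1
      ext w
      simp only [mem_cut, Finset.mem_filter, Finset.mem_univ, true_and, not_le, Fin.lt_def]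
      omega
    apply grundy_eq_of
    · intro v hv
      have hv : v.val < j := by simpa using hv
      rw [hcut v hv]
      exact hv.ne
    · intro m hm
      exact ⟨⟨m, hm.trans_le hj⟩, by simpa using hm, hcut ⟨m, _⟩ hm⟩

lemma grundy_univ_fin (k : ℕ) : grundy (Finset.univ : Finset (Fin k)) = k := by
  simpa using grundy_fin_lt k le_rfl

lemma grundy_cut_univ_fin {k : ℕ} (v : Fin k) : grundy (cut Finset.univ v) = v.val := by
  rw [← grundy_fin_lt v.val v.2.le]
  congr 1
  ext w
  simp

/-- Each bottom vertex raises the Grundy value by one. -/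
lemma grundy_lexPosition_fin (k : ℕ) (T : Finset W) :
    grundy (lexPosition (Fin k) T) = k + grundy T := by
  induction T using Finset.strongInduction with
  | H T ih =>
    have hl : ∀ v : Fin k, grundy (cut (lexPosition (Fin k) T) (Sum.inlₗ v)) = v.val := by
      intro v
      rw [cut_lexPosition_inlₗ, grundy_map, grundy_cut_univ_fin]
    have hr : ∀ w ∈ T, grundy (cut (lexPosition (Fin k) T) (Sum.inrₗ w)) =
        k + grundy (cut T w) := by
      intro w hw
      rw [cut_lexPosition_inrₗ, ih _ (cut_ssubset hw)]
    apply grundy_eq_of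
    · rintro (v | w) hx
      · have := hl v
        have hv := v.2
        exact fun h => absurd (this.symm.trans h) (by omega)
      · have hw := inrₗ_mem_lexPosition.1 hx
        have := grundy_cut_ne hw
        exact fun h => absurd ((hr w hw).symm.trans h) (by omega)
    · intro m hm
      rcases lt_or_ge m k with h | h
      · exact ⟨_, inlₗ_mem_lexPosition T ⟨m, h⟩, hl _⟩
      · obtain ⟨w, hw, e⟩ := exists_grundy_cut_eq (show m - k < grundy T by omega)
        exact ⟨_, inrₗ_mem_lexPosition.2 hw, by rw [hr w hw, e]; omega⟩

end Positions

/-! ### The constructions on games -/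

/-- The step for `i` acts on the binary digits from `i` on as half of a number, rounded up. -/
lemma add_xor_two_pow_div (x i : ℕ) :
    ((2 ^ i + x) ^^^ 2 ^ i) / 2 ^ (i + 1) = (x / 2 ^ i + 1) / 2 := by
  have h : (0 : ℕ) < 2 ^ i := by positivity
  rw [pow_succ, ← Nat.div_div_eq_div_mul, Nat.xor_div_two_pow, Nat.div_self h,
    Nat.add_div_left _ h, Nat.xor_div_two]
  simp

lemma two_pow_add_eq_xor {r k : ℕ} (h : r < 2 ^ k) : 2 ^ k + r = 2 ^ k ^^^ r := by
  have e := Nat.two_pow_add_eq_or_of_lt h 1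
  rw [mul_one] at e
  rw [e]
  apply Nat.eq_of_testBit_eq
  intro j
  rw [Nat.testBit_or, Nat.testBit_xor, Nat.testBit_two_pow]
  by_cases e : k = j
  · subst e
    simp [Nat.testBit_lt_two_pow h]
  · simp [e]

/-- A number `x` with `2 ^ i ≤ x < 2 ^ (i + 1)` turns into `x + 2 ^ (i + 1)` by the step for `i`. -/
lemma xor_xor_eq_zero_of_div_eq_one {x i : ℕ} (h : x / 2 ^ i = 1) :
    x ^^^ ((2 ^ i + x) ^^^ 2 ^ i) ^^^ 2 ^ (i + 1) = 0 := by
  have hpos : 0 < 2 ^ i := by positivity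
  have hr : x % 2 ^ i < 2 ^ i := Nat.mod_lt _ hpos
  have hx : x = 2 ^ i + x % 2 ^ i := by
    conv_lhs => rw [← Nat.div_add_mod x (2 ^ i), h, mul_one]
  generalize x % 2 ^ i = r at hr hx
  have h₁ : x = 2 ^ i ^^^ r := by rw [hx, two_pow_add_eq_xor hr]
  have h₂ : 2 ^ i + x = 2 ^ (i + 1) ^^^ r := by
    rw [← two_pow_add_eq_xor (by rw [pow_succ]; omega), hx, pow_succ]
    omega
  rw [h₂, h₁]
  apply Nat.eq_of_testBit_eq
  intro j
  simp only [Nat.testBit_xor, Nat.zero_testBit]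
  cases (2 ^ i).testBit j <;> cases (2 ^ (i + 1)).testBit j <;> cases r.testBit j <;> rfl

namespace PosetGame

variable (A B G : PosetGame)

/-- The Grundy value of the starting position. -/
noncomputable def nimber : ℕ := grundy (Finset.univ : Finset G.V)

lemma firstPlayerWins_iff_nimber_ne_zero : G.FirstPlayerWins ↔ G.nimber ≠ 0 :=
  playerToMoveWins_iff_grundy_ne_zero _

lemma nimber_le_size : G.nimber ≤ G.size := grundy_le_card _

lemma firstPlayerWins_congr {A B : PosetGame} (e : A.V ≃o B.V) :
    A.FirstPlayerWins ↔ B.FirstPlayerWins := by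
  rw [firstPlayerWins_iff_nimber_ne_zero, firstPlayerWins_iff_nimber_ne_zero, nimber, nimber,
    ← grundy_map e.toOrderEmbedding]
  have h : (Finset.univ : Finset A.V).map e.toOrderEmbedding.toEmbedding = Finset.univ := by
    ext b
    simpa using ⟨e.symm b, by simp⟩
  rw [h]

lemma univ_below : (Finset.univ : Finset (below A B).V) =
    lexPosition A.V (Finset.univ : Finset B.V) := by
  ext x
  rcases x with (a | b)
  · exact iff_of_true (Finset.mem_univ _) (inlₗ_mem_lexPosition _ a)
  · exact iff_of_true (Finset.mem_univ _) (inrₗ_mem_lexPosition.2 (Finset.mem_univ b))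

lemma nimber_tower (k : ℕ) : (tower k).nimber = k := grundy_univ_fin k

lemma nimber_beside : (beside A B).nimber = A.nimber ^^^ B.nimber := by
  rw [nimber, nimber, nimber, ← grundy_disjSum]
  congr 1

lemma nimber_addBottom (k : ℕ) : (addBottom k G).nimber = k + G.nimber := by
  rw [nimber, addBottom, univ_below]
  exact grundy_lexPosition_fin k _

lemma nimber_step (i : ℕ) : (step i G).nimber = (2 ^ i + G.nimber) ^^^ 2 ^ i := by
  rw [step, nimber_beside, nimber_addBottom, nimber_tower]

lemma size_tower (k : ℕ) : (tower k).size = k := Fintype.card_fin k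

lemma size_beside : (beside A B).size = A.size + B.size := Fintype.card_sum

lemma size_below : (below A B).size = A.size + B.size := Fintype.card_sum

lemma size_step (i : ℕ) : (step i G).size = G.size + 2 * 2 ^ i := by
  rw [step, addBottom, size_beside, size_below, size_tower]
  ring

lemma size_steps (i : ℕ) : (steps i G).size + 2 = G.size + 2 * 2 ^ i := by
  induction i with
  | zero => simp [steps]
  | succ i ih => rw [steps, size_step, pow_succ]; omega

lemma size_or : (A.or B).size = A.size + B.size := size_below A B

lemma size_neg : G.neg.size + 4 = 2 * G.size + 8 * 2 ^ Nat.size G.size := by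
  have h := size_steps G (Nat.size G.size)
  simp only [neg, size_beside, size_step, size_tower, pow_succ]
  omega

lemma size_neg_pos : 0 < G.neg.size := by
  have h := size_neg G
  have : 0 < 2 ^ Nat.size G.size := by positivity
  omega

lemma size_neg_le (h : 0 < G.size) : G.neg.size ≤ 26 * G.size := by
  have h₁ := size_neg G
  have h₂ : 2 ^ Nat.size G.size ≤ 2 * G.size := by
    obtain ⟨m, hm⟩ : ∃ m, Nat.size G.size = m + 1 :=
      Nat.exists_eq_succ_of_ne_zero (Nat.size_pos.2 h).ne'
    have : 2 ^ m ≤ G.size := Nat.lt_size.1 (by omega)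
    rw [hm, pow_succ]
    omega
  omega

lemma size_and_le (hA : 0 < A.size) (hB : 0 < B.size) :
    (A.and B).size ≤ 26 ^ 2 * (A.size + B.size) := by
  have h₁ := size_neg_le A hA
  have h₂ := size_neg_le B hB
  have h₃ := size_neg_le (or (neg A) (neg B)) (by rw [size_or]; have := size_neg_pos A; omega)
  rw [size_or] at h₃
  rw [and]
  omega

lemma firstPlayerWins_or : (A.or B).FirstPlayerWins ↔ A.FirstPlayerWins ∨ B.FirstPlayerWins := by
  rw [FirstPlayerWins, or, univ_below]
  exact playerToMoveWins_lexPosition _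

lemma nimber_steps_of_eq_zero (h : G.nimber = 0) (i : ℕ) : (steps i G).nimber = 0 := by
  induction i with
  | zero => exact h
  | succ i ih => rw [steps, nimber_step, ih, add_zero, Nat.xor_self]

lemma nimber_steps_div_pos (h : 0 < G.nimber) (i : ℕ) : 0 < (steps i G).nimber / 2 ^ i := by
  induction i with
  | zero => simpa [steps] using h
  | succ i ih => rw [steps, nimber_step, add_xor_two_pow_div]; omega

/-- Halving `i` times with rounding up takes a number at most `2 ^ (i + k)` to one at most
`2 ^ k`. -/
lemma nimber_steps_div_le (i k : ℕ) (h : G.nimber ≤ 2 ^ (i + k)) :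
    (steps i G).nimber / 2 ^ i ≤ 2 ^ k := by
  induction i generalizing k with
  | zero => simpa [steps] using h
  | succ i ih =>
    have := ih (k + 1) (by rwa [← add_assoc, add_right_comm])
    rw [steps, nimber_step, add_xor_two_pow_div]
    rw [pow_succ] at this
    omega

/-- When the steps for all binary digits of the size are made, a non-zero Grundy value has
become a number with leading digit at `Nat.size G.size`. -/
lemma nimber_steps_div_eq_one (h : 0 < G.nimber) :
    (steps (Nat.size G.size) G).nimber / 2 ^ Nat.size G.size = 1 :=
  le_antisymm
    (nimber_steps_div_le G _ 0 ((nimber_le_size G).trans (Nat.lt_size_self _).le))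
    (nimber_steps_div_pos G h _)

lemma firstPlayerWins_neg : G.neg.FirstPlayerWins ↔ ¬ G.FirstPlayerWins := by
  rw [firstPlayerWins_iff_nimber_ne_zero, firstPlayerWins_iff_nimber_ne_zero, not_not]
  simp only [neg, nimber_beside, nimber_step, nimber_tower]
  rcases Nat.eq_zero_or_pos G.nimber with h | h
  · rw [nimber_steps_of_eq_zero G h]
    simp [h]
  · rw [xor_xor_eq_zero_of_div_eq_one (nimber_steps_div_eq_one G h)]
    simp [h.ne']

lemma firstPlayerWins_and :
    (A.and B).FirstPlayerWins ↔ A.FirstPlayerWins ∧ B.FirstPlayerWins := by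
  rw [and, firstPlayerWins_neg, firstPlayerWins_or, firstPlayerWins_neg, firstPlayerWins_neg]
  tauto

end PosetGame

/-! ### Games of formulas -/

namespace BoolFormula

variable {n : ℕ}

/-- The game of a formula, with arbitrary games `leaf b` for the truth values at the leaves. -/
def gameWith (leaf : Bool → PosetGame) (x : Fin n → Bool) : BoolFormula n → PosetGame
  | const b => leaf b
  | var i => leaf (x i)
  | not φ => (φ.gameWith leaf x).neg
  | and φ ψ => (φ.gameWith leaf x).and (ψ.gameWith leaf x)
  | or φ ψ => (φ.gameWith leaf x).or (ψ.gameWith leaf x)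

lemma game_eq_gameWith (x : Fin n → Bool) (φ : BoolFormula n) :
    φ.game x = φ.gameWith PosetGame.ofBool x := by
  induction φ with
  | const b => rfl
  | var i => rfl
  | not φ ih => rw [game, gameWith, ih]
  | and φ ψ ih₁ ih₂ => rw [game, gameWith, ih₁, ih₂]
  | or φ ψ ih₁ ih₂ => rw [game, gameWith, ih₁, ih₂]

lemma firstPlayerWins_gameWith {leaf : Bool → PosetGame}
    (h : ∀ b, (leaf b).FirstPlayerWins ↔ b = true) (x : Fin n → Bool) (φ : BoolFormula n) :
    (φ.gameWith leaf x).FirstPlayerWins ↔ φ.eval x = true := by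
  induction φ with
  | const b => exact h b
  | var i => exact h (x i)
  | not φ ih => rw [gameWith, PosetGame.firstPlayerWins_neg, ih]; simp [eval]
  | and φ ψ ih₁ ih₂ => rw [gameWith, PosetGame.firstPlayerWins_and, ih₁, ih₂]; simp [eval]
  | or φ ψ ih₁ ih₂ => rw [gameWith, PosetGame.firstPlayerWins_or, ih₁, ih₂]; simp [eval]

/-- Each connective multiplies the largest size by at most `2 ^ 11`: an AND of games of size at
most `s` has size at most `26 ^ 2 * (s + s)`, and `2 * 26 ^ 2 ≤ 2 ^ 11`. -/
lemma size_gameWith {leaf : Bool → PosetGame} (h₀ : ∀ b, 0 < (leaf b).size)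
    (h₂ : ∀ b, (leaf b).size ≤ 2) (x : Fin n → Bool) (φ : BoolFormula n) :
    0 < (φ.gameWith leaf x).size ∧ (φ.gameWith leaf x).size ≤ 2 * (2 ^ 11) ^ φ.depth := by
  induction φ with
  | const b => exact ⟨h₀ b, by simpa [depth, gameWith] using h₂ b⟩
  | var i => exact ⟨h₀ (x i), by simpa [depth, gameWith] using h₂ (x i)⟩
  | not φ ih =>
    have h := PosetGame.size_neg_le _ ih.1
    refine ⟨PosetGame.size_neg_pos _, ?_⟩
    rw [depth, gameWith, pow_succ]
    omega
  | and φ ψ ih₁ ih₂ =>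
    have h := PosetGame.size_and_le _ _ ih₁.1 ih₂.1
    have e₁ : (2 ^ 11) ^ φ.depth ≤ (2 ^ 11) ^ max φ.depth ψ.depth :=
      Nat.pow_le_pow_right (by norm_num) (le_max_left _ _)
    have e₂ : (2 ^ 11) ^ ψ.depth ≤ (2 ^ 11) ^ max φ.depth ψ.depth :=
      Nat.pow_le_pow_right (by norm_num) (le_max_right _ _)
    refine ⟨PosetGame.size_neg_pos _, ?_⟩
    rw [depth, gameWith, pow_succ]
    omega
  | or φ ψ ih₁ ih₂ =>
    have e₁ : (2 ^ 11) ^ φ.depth ≤ (2 ^ 11) ^ max φ.depth ψ.depth :=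
      Nat.pow_le_pow_right (by norm_num) (le_max_left _ _)
    have e₂ : (2 ^ 11) ^ ψ.depth ≤ (2 ^ 11) ^ max φ.depth ψ.depth :=
      Nat.pow_le_pow_right (by norm_num) (le_max_right _ _)
    rw [depth, gameWith, pow_succ, PosetGame.size_or]
    omega

/-- A bound for the sizes of the games of formulas of depth at most `c * (Nat.log 2 n + 1)`,
as a polynomial in `n`. -/
noncomputable def sizeBound (c : ℕ) : Polynomial ℕ := 2 * (2 * (Polynomial.X + 1)) ^ (11 * c)

lemma size_gameWith_le_eval_sizeBound {leaf : Bool → PosetGame} (h₀ : ∀ b, 0 < (leaf b).size)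
    (h₂ : ∀ b, (leaf b).size ≤ 2) (c : ℕ) (x : Fin n → Bool) (φ : BoolFormula n)
    (hφ : φ.depth ≤ c * (Nat.log 2 n + 1)) :
    (φ.gameWith leaf x).size ≤ (sizeBound c).eval n := by
  -- `Nat.log 2 0 = 0`, so that the bound `n` fails for `n = 0`
  have hlog : 2 ^ Nat.log 2 n ≤ n + 1 := by
    rcases Nat.eq_zero_or_pos n with rfl | hn
    · simp
    · exact (Nat.pow_log_le_self 2 hn.ne').trans n.le_succ
  calc (φ.gameWith leaf x).size ≤ 2 * (2 ^ 11) ^ φ.depth := (size_gameWith h₀ h₂ x φ).2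
    _ ≤ 2 * (2 ^ 11) ^ (c * (Nat.log 2 n + 1)) := by
        gcongr
        norm_num
    _ = 2 * (2 * 2 ^ Nat.log 2 n) ^ (11 * c) := by
        rw [← pow_succ', ← pow_mul, ← pow_mul]
        congr 2
        ring
    _ ≤ 2 * (2 * (n + 1)) ^ (11 * c) := by gcongr
    _ = (sizeBound c).eval n := by simp [sizeBound]

end BoolFormula

namespace PosetGame

lemma firstPlayerWins_beside_self (G : PosetGame) : ¬ (beside G G).FirstPlayerWins := by
  rw [firstPlayerWins_iff_nimber_ne_zero, nimber_beside, Nat.xor_self]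
  simp

lemma firstPlayerWins_tower_succ (k : ℕ) : (tower (k + 1)).FirstPlayerWins := by
  rw [firstPlayerWins_iff_nimber_ne_zero, nimber_tower]
  simp

lemma firstPlayerWins_ofBool (b : Bool) : (ofBool b).FirstPlayerWins ↔ b = true := by
  cases b
  · simpa using! firstPlayerWins_beside_self (tower 1)
  · simpa using! firstPlayerWins_tower_succ 0

lemma size_ofBool (b : Bool) : 0 < (ofBool b).size ∧ (ofBool b).size ≤ 2 := by
  cases b <;> simp [ofBool, size_beside, size_tower]

/-- A truth value as a game with two vertices: a chain for true, an antichain for false. -/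
def pairOfBool : Bool → PosetGame
  | true => tower 2
  | false => beside (tower 1) (tower 1)

lemma firstPlayerWins_pairOfBool (b : Bool) : (pairOfBool b).FirstPlayerWins ↔ b = true := by
  cases b
  · simpa using! firstPlayerWins_beside_self (tower 1)
  · simpa using! firstPlayerWins_tower_succ 1

lemma size_pairOfBool (b : Bool) : (pairOfBool b).size = 2 := by
  cases b <;> simp [pairOfBool, size_beside, size_tower]

end PosetGame

/-! ### Unfolding circuits into formulas -/

lemma BoolCircuit.exists_formula_gate {n : ℕ} (C : BoolCircuit n) (g : Fin C.size) :
    ∃ φ : BoolFormula n, (∀ x, φ.eval x = C.gateVal x g) ∧ φ.depth = C.gateDepth g := by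
  obtain ⟨g, hg⟩ := g
  induction g using Nat.strong_induction_on with
  | _ g ih =>
    rcases h : C.gate ⟨g, hg⟩ with i | b | a | ⟨a, b⟩ | ⟨a, b⟩
    · refine ⟨.var i, fun x => ?_, ?_⟩
      · rw [gateVal, h, BoolFormula.eval]
      · rw [gateDepth, h, BoolFormula.depth]
    · refine ⟨.const b, fun x => ?_, ?_⟩
      · rw [gateVal, h, BoolFormula.eval]
      · rw [gateDepth, h, BoolFormula.depth]
    · obtain ⟨φ, e, d⟩ := ih a a.2 (a.2.trans hg)
      refine ⟨.not φ, fun x => ?_, ?_⟩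
      · rw [gateVal, h, BoolFormula.eval, e]
      · rw [gateDepth, h, BoolFormula.depth, d]
    · obtain ⟨φ, e, d⟩ := ih a a.2 (a.2.trans hg)
      obtain ⟨ψ, e', d'⟩ := ih b b.2 (b.2.trans hg)
      refine ⟨.and φ ψ, fun x => ?_, ?_⟩
      · rw [gateVal, h, BoolFormula.eval, e, e']
      · rw [gateDepth, h, BoolFormula.depth, d, d']
    · obtain ⟨φ, e, d⟩ := ih a a.2 (a.2.trans hg)
      obtain ⟨ψ, e', d'⟩ := ih b b.2 (b.2.trans hg)
      refine ⟨.or φ ψ, fun x => ?_, ?_⟩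
      · rw [gateVal, h, BoolFormula.eval, e, e']
      · rw [gateDepth, h, BoolFormula.depth, d, d']

lemma BoolCircuit.exists_formula {n : ℕ} (C : BoolCircuit n) :
    ∃ φ : BoolFormula n, (∀ x, φ.eval x = C.eval x) ∧ φ.depth ≤ C.depth := by
  obtain ⟨φ, e, d⟩ := C.exists_formula_gate C.output
  exact ⟨φ, e, d.trans_le (Finset.le_sup (f := C.gateDepth) (Finset.mem_univ C.output))⟩

/-! ### Games whose order is a projection of the input -/

/-- A family of games, one for each input, whose order is computed by a projection: up to
isomorphism all games have the same vertices, and each bit of the matrix of `≤` is a constant,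
an input bit or a negated one. -/
def IsProjection {n : ℕ} (F : (Fin n → Bool) → PosetGame) : Prop :=
  ∃ (ι : Type) (_ : Fintype ι) (π : ι → ι → ProjBit n),
    ∀ x, ∃ e : ι ≃ (F x).V, ∀ i j, (π i j).eval x = true ↔ e i ≤ e j

namespace IsProjection

variable {n : ℕ} {F F' : (Fin n → Bool) → PosetGame}

open Classical in
lemma const (G : PosetGame) : IsProjection fun _ : Fin n → Bool => G :=
  ⟨G.V, G.fintype, fun i j => .const (decide (i ≤ j)), fun _ =>
    ⟨Equiv.refl _, fun _ _ => by simp [ProjBit.eval]⟩⟩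

lemma beside (h : IsProjection F) (h' : IsProjection F') :
    IsProjection fun x => (F x).beside (F' x) := by
  obtain ⟨ι, _, π, hπ⟩ := h
  obtain ⟨ι', _, π', hπ'⟩ := h'
  refine ⟨ι ⊕ ι', inferInstance, fun i j => match i, j with
    | .inl i, .inl j => π i j
    | .inr i, .inr j => π' i j
    | _, _ => .const false, fun x => ?_⟩
  obtain ⟨e, he⟩ := hπ x
  obtain ⟨e', he'⟩ := hπ' x
  refine ⟨Equiv.sumCongr e e', ?_⟩
  rintro (i | i) (j | j)
  · exact (he i j).trans Sum.inl_le_inl_iff.symm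
  · exact iff_of_false (by simp [ProjBit.eval]) Sum.not_inl_le_inr
  · exact iff_of_false (by simp [ProjBit.eval]) Sum.not_inr_le_inl
  · exact (he' i j).trans Sum.inr_le_inr_iff.symm

lemma below (h : IsProjection F) (h' : IsProjection F') :
    IsProjection fun x => (F x).below (F' x) := by
  obtain ⟨ι, _, π, hπ⟩ := h
  obtain ⟨ι', _, π', hπ'⟩ := h'
  refine ⟨ι ⊕ ι', inferInstance, fun i j => match i, j with
    | .inl i, .inl j => π i j
    | .inr i, .inr j => π' i j
    | .inl _, .inr _ => .const true
    | .inr _, .inl _ => .const false, fun x => ?_⟩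
  obtain ⟨e, he⟩ := hπ x
  obtain ⟨e', he'⟩ := hπ' x
  refine ⟨(Equiv.sumCongr e e').trans toLex, ?_⟩
  rintro (i | i) (j | j)
  · exact (he i j).trans Sum.Lex.inl_le_inl_iff.symm
  · exact iff_of_true (by simp [ProjBit.eval]) (Sum.Lex.inl_le_inr _ _)
  · exact iff_of_false (by simp [ProjBit.eval]) Sum.Lex.not_inr_le_inl
  · exact (he' i j).trans Sum.Lex.inr_le_inr_iff.symm

lemma step (i : ℕ) (h : IsProjection F) : IsProjection fun x => (F x).step i :=
  ((const _).below h).beside (const _)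

lemma steps (i : ℕ) (h : IsProjection F) : IsProjection fun x => (F x).steps i := by
  induction i with
  | zero => exact h
  | succ i ih => exact ih.step i

lemma size_eq (h : IsProjection F) : ∃ m, ∀ x, (F x).size = m := by
  obtain ⟨ι, _, π, hπ⟩ := h
  refine ⟨Fintype.card ι, fun x => ?_⟩
  obtain ⟨e, -⟩ := hπ x
  exact (Fintype.card_congr e).symm

/-- The number of steps of the NOT construction depends on the size of the game only, which is
the same for all inputs. -/
lemma neg (h : IsProjection F) : IsProjection fun x => (F x).neg := by
  obtain ⟨m, hm⟩ := h.size_eq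
  simp only [PosetGame.neg, hm]
  exact ((h.steps _).beside ((h.steps _).step _)).beside (const _)

lemma and (h : IsProjection F) (h' : IsProjection F') :
    IsProjection fun x => (F x).and (F' x) :=
  (h.neg.below h'.neg).neg

lemma pairOfBool (i : Fin n) : IsProjection fun x => PosetGame.pairOfBool (x i) := by
  refine ⟨Fin 2, inferInstance, ![![.const true, .pos i], ![.const false, .const true]],
    fun x => ?_⟩
  beta_reduce
  cases h : x i
  · refine ⟨(finSumFinEquiv (m := 1) (n := 1)).symm, ?_⟩
    intro a b
    fin_cases a <;> fin_cases b
    · exact iff_of_true rfl le_rfl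
    · exact iff_of_false (by simp [ProjBit.eval, h]) Sum.not_inl_le_inr
    · exact iff_of_false (by simp [ProjBit.eval]) Sum.not_inr_le_inl
    · exact iff_of_true rfl le_rfl
  · refine ⟨Equiv.refl (Fin 2), ?_⟩
    intro a b
    fin_cases a <;> fin_cases b
    · exact iff_of_true rfl le_rfl
    · exact iff_of_true (by simp [ProjBit.eval, h]) (Fin.zero_le (1 : Fin 2))
    · exact iff_of_false (by simp [ProjBit.eval]) (by decide : ¬ (1 : Fin 2) ≤ 0)
    · exact iff_of_true rfl le_rfl

lemma gameWith_pairOfBool (φ : BoolFormula n) :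
    IsProjection fun x => φ.gameWith PosetGame.pairOfBool x := by
  induction φ with
  | const b => exact const _
  | var i => exact pairOfBool i
  | not φ ih => exact ih.neg
  | and φ ψ ih₁ ih₂ => exact ih₁.and ih₂
  | or φ ψ ih₁ ih₂ => exact ih₁.below ih₂

end IsProjection

/-! ### Hardness -/

lemma encodeOrder_injective {m : ℕ} {o o' : PartialOrder (Fin m)}
    (h : encodeOrder o = encodeOrder o') : o = o' := by
  have h' := List.ofFn_injective h
  apply PartialOrder.ext
  intro i j
  simpa using congrFun h' (finProdFinEquiv (i, j))

lemma encodeOrder_mem_posetGameWinner {m : ℕ} (o : PartialOrder (Fin m)) :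
    encodeOrder o ∈ posetGameWinner ↔ (@PosetGame.mk (Fin m) o _).FirstPlayerWins := by
  constructor
  · rintro ⟨m', o', h, hw⟩
    have hm : m = m' := by
      have := congrArg List.length h
      simp only [encodeOrder, List.length_ofFn] at this
      exact Nat.mul_self_inj.1 this
    subst hm
    rwa [encodeOrder_injective h]
  · exact fun h => ⟨m, o, rfl, h⟩

/-- The matrix of a projection family, as a projection to strings. -/
lemma IsProjection.exists_matrix {n : ℕ} {F : (Fin n → Bool) → PosetGame} (h : IsProjection F) :
    ∃ (m : ℕ) (π : Fin (m * m) → ProjBit n), (∀ x, (F x).size = m) ∧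
      ∀ x, List.ofFn (fun k => (π k).eval x) ∈ posetGameWinner ↔ (F x).FirstPlayerWins := by
  obtain ⟨ι, _, π, hπ⟩ := h
  let f := (Fintype.equivFin ι).symm
  refine ⟨Fintype.card ι, fun k => π (f (finProdFinEquiv.symm k).1) (f (finProdFinEquiv.symm k).2),
    fun x => (Fintype.card_congr (hπ x).choose).symm, fun x => ?_⟩
  obtain ⟨e, he⟩ := hπ x
  let o : PartialOrder (Fin (Fintype.card ι)) :=
    PartialOrder.lift (fun i => e (f i)) (e.injective.comp f.injective)
  have hcode : List.ofFn (fun k : Fin (Fintype.card ι * Fintype.card ι) =>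
      (π (f (finProdFinEquiv.symm k).1) (f (finProdFinEquiv.symm k).2)).eval x) =
      encodeOrder o := by
    rw [encodeOrder]
    congr 1
    funext k
    exact Bool.eq_iff_iff.2 ((he _ _).trans
      (@decide_eq_true_iff _ (Classical.propDecidable _)).symm)
  rw [hcode, encodeOrder_mem_posetGameWinner]
  exact PosetGame.firstPlayerWins_congr (A := @PosetGame.mk _ o _)
    (@RelIso.mk _ _ o.le (· ≤ ·) (f.trans e) Iff.rfl)

lemma nc1Hard_posetGameWinner : NC1Hard posetGameWinner := by
  rintro L ⟨C, -, ⟨c, hc⟩, hL⟩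
  choose φ hφ hd using fun n => (C n).exists_formula
  choose m π hm hπ using fun n => (IsProjection.gameWith_pairOfBool (φ n)).exists_matrix
  refine ⟨fun n => m n * m n, π, ⟨BoolFormula.sizeBound c * BoolFormula.sizeBound c, fun n => ?_⟩,
    fun w => ?_⟩
  · have h : m n ≤ (BoolFormula.sizeBound c).eval n := by
      rw [← hm n fun _ => false]
      exact BoolFormula.size_gameWith_le_eval_sizeBound (fun b => by simp [PosetGame.size_pairOfBool])
        (fun b => (PosetGame.size_pairOfBool b).le) c _ _ ((hd n).trans (hc n))
    rw [Polynomial.eval_mul]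
    exact Nat.mul_le_mul h h
  · rw [hL, ← hφ, hπ, BoolFormula.firstPlayerWins_gameWith PosetGame.firstPlayerWins_pairOfBool]

theorem mainTheorem4 :
    -- the OR construction, with its size
    (∀ A B : PosetGame,
      ((A.or B).FirstPlayerWins ↔ A.FirstPlayerWins ∨ B.FirstPlayerWins) ∧
      (A.or B).size = A.size + B.size) ∧
    -- the NOT construction, with linear blowup
    (∀ G : PosetGame,
      (G.neg.FirstPlayerWins ↔ ¬ G.FirstPlayerWins) ∧
      (0 < G.size → G.neg.size ≤ 26 * G.size)) ∧
    -- the AND construction, with linear blowup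
    (∀ A B : PosetGame,
      ((A.and B).FirstPlayerWins ↔ A.FirstPlayerWins ∧ B.FirstPlayerWins) ∧
      (0 < A.size → 0 < B.size → (A.and B).size ≤ 26 ^ 2 * (A.size + B.size))) ∧
    -- the game of a formula is a first-player win iff the formula is true
    (∀ (n : ℕ) (φ : BoolFormula n) (x : Fin n → Bool),
      (φ.game x).FirstPlayerWins ↔ φ.eval x = true) ∧
    -- formulas of logarithmic depth have games of polynomial size
    (∀ c : ℕ, ∃ p : Polynomial ℕ, ∀ (n : ℕ) (φ : BoolFormula n) (x : Fin n → Bool),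
      φ.depth ≤ c * (Nat.log 2 n + 1) → (φ.game x).size ≤ p.eval n) ∧
    -- deciding the winner of a poset game is hard for NC¹
    NC1Hard posetGameWinner := by
  refine ⟨fun A B => ⟨PosetGame.firstPlayerWins_or A B, PosetGame.size_or A B⟩,
    fun G => ⟨PosetGame.firstPlayerWins_neg G, PosetGame.size_neg_le G⟩,
    fun A B => ⟨PosetGame.firstPlayerWins_and A B, PosetGame.size_and_le A B⟩,
    fun n φ x => ?_, fun c => ⟨BoolFormula.sizeBound c, fun n φ x h => ?_⟩,
    nc1Hard_posetGameWinner⟩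
  · rw [BoolFormula.game_eq_gameWith]
    exact BoolFormula.firstPlayerWins_gameWith PosetGame.firstPlayerWins_ofBool x φ
  · rw [BoolFormula.game_eq_gameWith]
    exact BoolFormula.size_gameWith_le_eval_sizeBound (fun b => (PosetGame.size_ofBool b).1)
      (fun b => (PosetGame.size_ofBool b).2) c x φ h
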